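/- For real $n>0$ let $I(n)=\int_0^1 \left(x^n+(1-x)^n\right)^{1/n}\,dx$. Then, as $n\to\infty$ through the real numbers (in particular through the positive integers), $I(n)$ has a full asymptotic expansion $$I(n)\sim \sum_{i\ge 0}\frac{I_i}{n^i},$$ that is, there are real numbers $I_0,I_1,I_2,\dots$ such that, for every integer $N\ge 0$, $I(n)-\sum_{i=0}^{N} I_i n^{-i}=o(n^{-N})$ as $n\to\infty$. Its first coefficients are $$I_0=\frac34,\quad I_1=0,\quad I_2=\frac{\pi^2}{48},\quad I_3=\frac{\zeta(3)}{8},\quad I_4=-\frac{\pi^4}{960},\quad I_5=-\frac{\zeta(3)\,\pi^2}{48},$$ where $\zeta$ is the Riemann zeta function. -/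

import Mathlib

open Filter Asymptotics

/-- The integral `I(n) = ∫₀¹ (xⁿ + (1 - x)ⁿ)^(1/n) dx`, for a real parameter `n`. -/
noncomputable def powerMeanIntegral (n : ℝ) : ℝ :=
  ∫ x in (0 : ℝ)..1, (x ^ n + (1 - x) ^ n) ^ (1 / n)

/-- `f(n) ~ ∑_{i ≥ 0} c i / nⁱ` as `n → ∞` in the sense of Poincaré: for every `N`, the error of the
partial sum up to and including the index `N` is `o(n^(-N))`. -/
def HasAsymptoticExpansion (f : ℝ → ℝ) (c : ℕ → ℝ) : Prop :=
  ∀ N : ℕ, (fun n : ℝ => f n - ∑ i ∈ Finset.range (N + 1), c i / n ^ i)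
    =o[atTop] fun n : ℝ => 1 / n ^ N

/-!
By the symmetry `x ↦ 1 - x` it suffices to integrate over `x > 1/2`, where `x = sigmoid (u / n)`
gives `I(n) = 3/4 + (2/n) ∫₀^∞ ((1 + e^(-u))^(1/n) - 1) g(u/n) du` with
`g = sigmoid² (1 - sigmoid)`. Expanding the integrand in powers of `ε = 1/n` yields the asymptotic
expansion.

The first factor vanishes at `ε = 0`, so the coefficient of `ε ^ m` in this integral involves only
the Taylor coefficients of `g` of order less than `m`. Those of order at most three are
`(-1) ^ k / 8` times the ones of `Re e^(ω s)`, with `ω` a primitive cube root of unity. Up to sign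
and scale, the first five coefficients are therefore those of
`K(ε) = ∫₀^∞ ((1 + e^(-u))^(-ε) - 1) Re e^(ω ε u) du`, and this integral is a Beta function:
`1 + 2 ε K(ε) = ε B(-ω ε, -ω̄ ε) = ∏_{j ≥ 1} (1 - (ε/j)²) / (1 - (ε/j)³)`.
The logarithm of the product is a power series in `ε` whose coefficients are zeta values.
-/

open MeasureTheory Set Topology Polynomial
open scoped ContDiff Nat

/-! ### Expansions with explicit error bounds -/

/-- `∑ a k * s ^ k` is an asymptotic expansion of `f` at `0`, whose error after `N` terms is at most
`C N * s ^ N` on `S`. The constants are part of the data so that an expansion depending on a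
parameter can be integrated over that parameter. -/
def HasExpansionOn (f : ℝ → ℝ) (a C : ℕ → ℝ) (S : Set ℝ) : Prop :=
  ∀ N, ∀ s ∈ S, |f s - ∑ k ∈ Finset.range N, a k * s ^ k| ≤ C N * s ^ N

/-- The Taylor coefficients of `f` at `0`. -/
noncomputable def taylorCoeff (f : ℝ → ℝ) (k : ℕ) : ℝ :=
  iteratedDeriv k f 0 / k !

namespace HasExpansionOn

variable {f g : ℝ → ℝ} {a b A B : ℕ → ℝ} {S T : Set ℝ}

lemma mono (h : HasExpansionOn f a A S) (hAB : ∀ N, A N ≤ B N) (hTS : T ⊆ S) (hT : T ⊆ Ici 0) :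
    HasExpansionOn f a B T := fun N s hs =>
  (h N s (hTS hs)).trans (mul_le_mul_of_nonneg_right (hAB N) (pow_nonneg (hT hs) N))

lemma abs_le (h : HasExpansionOn f a A S) {s : ℝ} (hs : s ∈ S) : |f s| ≤ A 0 := by
  simpa using h 0 s hs

lemma const_nonneg (h : HasExpansionOn f a A S) (h1 : 1 ∈ S) (N : ℕ) : 0 ≤ A N := by
  simpa using (abs_nonneg _).trans (h N 1 h1)

lemma abs_coeff_le (h : HasExpansionOn f a A S) (h1 : 1 ∈ S) (m : ℕ) :
    |a m| ≤ A m + A (m + 1) := by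
  have hm := h m 1 h1
  have hm1 := h (m + 1) 1 h1
  simp only [Finset.sum_range_succ, one_pow, mul_one] at hm hm1
  calc |a m| = |(f 1 - ∑ k ∈ Finset.range m, a k) -
        (f 1 - (∑ k ∈ Finset.range m, a k + a m))| := by congr 1; ring
    _ ≤ _ := (abs_sub _ _).trans (add_le_add hm hm1)

lemma comp_mul_const (h : HasExpansionOn f a A (Ici 0)) {u : ℝ} (hu : 0 ≤ u) :
    HasExpansionOn (fun s => f (s * u)) (fun k => a k * u ^ k) (fun N => A N * u ^ N) (Ici 0) := by
  intro N s hs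
  have := h N (s * u) (mul_nonneg hs hu)
  simpa only [mul_pow, mul_assoc, mul_comm (s ^ _)] using this

lemma mul_sub_sum_eq (x y s : ℝ) (a b : ℕ → ℝ) (N : ℕ) :
    x * y - ∑ m ∈ Finset.range N, (∑ j ∈ Finset.range (m + 1), a j * b (m - j)) * s ^ m =
      ∑ j ∈ Finset.range N, a j * s ^ j * (y - ∑ k ∈ Finset.range (N - j), b k * s ^ k) +
        (x - ∑ j ∈ Finset.range N, a j * s ^ j) * y := by
  have cauchy : ∑ m ∈ Finset.range N, (∑ j ∈ Finset.range (m + 1), a j * b (m - j)) * s ^ m =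
      ∑ j ∈ Finset.range N, ∑ k ∈ Finset.range (N - j), a j * s ^ j * (b k * s ^ k) := by
    rw [← Finset.sum_range_diag_flip N fun j k => a j * s ^ j * (b k * s ^ k)]
    refine Finset.sum_congr rfl fun m _ => ?_
    rw [Finset.sum_mul]
    refine Finset.sum_congr rfl fun j hj => ?_
    rw [← pow_mul_pow_sub s (Finset.mem_range_succ_iff.1 hj)]
    ring
  rw [cauchy]
  simp only [mul_sub, sub_mul, Finset.sum_sub_distrib, Finset.mul_sum, Finset.sum_mul]
  ring

lemma mul (hf : HasExpansionOn f a A S) (hg : HasExpansionOn g b B S) (hS : S ⊆ Ici 0) :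
    HasExpansionOn (fun s => f s * g s) (fun m => ∑ j ∈ Finset.range (m + 1), a j * b (m - j))
      (fun N => ∑ j ∈ Finset.range N, |a j| * B (N - j) + A N * B 0) S := by
  intro N s hs
  have hs0 : 0 ≤ s := hS hs
  have left : ∀ j ∈ Finset.range N,
      |a j * s ^ j * (g s - ∑ k ∈ Finset.range (N - j), b k * s ^ k)| ≤
        |a j| * B (N - j) * s ^ N := fun j hj => by
    rw [abs_mul, abs_mul, abs_of_nonneg (pow_nonneg hs0 j),
      ← pow_mul_pow_sub s (Finset.mem_range.1 hj).le]
    calc |a j| * s ^ j * |g s - ∑ k ∈ Finset.range (N - j), b k * s ^ k|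
        ≤ |a j| * s ^ j * (B (N - j) * s ^ (N - j)) := by gcongr; exact hg _ s hs
      _ = _ := by ring
  have right : |(f s - ∑ j ∈ Finset.range N, a j * s ^ j) * g s| ≤ A N * B 0 * s ^ N := by
    rw [abs_mul, mul_right_comm]
    exact mul_le_mul (hf N s hs) (hg.abs_le hs) (abs_nonneg _) ((abs_nonneg _).trans (hf N s hs))
  rw [mul_sub_sum_eq, add_mul, Finset.sum_mul]
  exact (abs_add_le _ _).trans
    (add_le_add ((Finset.abs_sum_le_sum_abs _ _).trans (Finset.sum_le_sum left)) right)

lemma integral {α : Type*} [MeasurableSpace α] {μ : Measure α} {F : ℝ → α → ℝ} {a A : ℕ → α → ℝ}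
    (h : ∀ᵐ x ∂μ, HasExpansionOn (F · x) (a · x) (A · x) S) (h1 : 1 ∈ S)
    (hF : ∀ s ∈ S, AEStronglyMeasurable (F s) μ) (ha : ∀ m, AEStronglyMeasurable (a m) μ)
    (hA : ∀ N, Integrable (A N) μ) :
    HasExpansionOn (fun s => ∫ x, F s x ∂μ) (fun m => ∫ x, a m x ∂μ)
      (fun N => ∫ x, A N x ∂μ) S := by
  intro N s hs
  have hFs : Integrable (F s) μ := (hA 0).mono' (hF s hs) (h.mono fun x hx => hx.abs_le hs)
  have has : ∀ m ∈ Finset.range N, Integrable (fun x => a m x * s ^ m) μ := fun m _ =>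
    (((hA m).add (hA (m + 1))).mono' (ha m) (h.mono fun x hx => hx.abs_coeff_le h1 m)).mul_const _
  simp only [← integral_mul_const]
  rw [← integral_finsetSum _ has, ← integral_sub hFs (integrable_finsetSum _ has)]
  have bound : ∀ᵐ x ∂μ, ‖F s x - ∑ m ∈ Finset.range N, a m x * s ^ m‖ ≤ A N x * s ^ N :=
    h.mono fun x hx => hx N s hs
  exact norm_integral_le_of_norm_le ((hA N).mul_const _) bound

lemma of_contDiff (hf : ContDiff ℝ ∞ f) (hA : ∀ N s, 0 ≤ s → |iteratedDeriv N f s| ≤ A N) :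
    HasExpansionOn f (taylorCoeff f) A (Ici 0) := by
  rintro (_ | n) s (hs : 0 ≤ s)
  · simpa using hA 0 s hs
  rcases hs.eq_or_lt with rfl | hs
  · simp [Finset.sum_range_succ', taylorCoeff]
  obtain ⟨t, ht, hft⟩ := taylor_mean_remainder_lagrange_iteratedDeriv (n := n) hs.ne
    (hf.of_le (mod_cast le_top)).contDiffOn
  have htaylor : taylorWithinEval f n (uIcc 0 s) 0 s =
      ∑ k ∈ Finset.range (n + 1), taylorCoeff f k * s ^ k := by
    rw [taylor_within_apply]
    refine Finset.sum_congr rfl fun k _ => ?_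
    rw [iteratedDerivWithin_eq_iteratedDeriv (uniqueDiffOn_uIcc hs.ne)
      (hf.of_le (mod_cast le_top)).contDiffAt left_mem_uIcc, taylorCoeff, smul_eq_mul]
    ring
  rw [uIoo_of_lt hs] at ht
  rw [← htaylor, hft, sub_zero, abs_div, abs_mul, abs_of_nonneg (pow_nonneg hs.le _), Nat.abs_cast]
  have hbound := mul_le_mul_of_nonneg_right (hA (n + 1) t ht.1.le) (pow_nonneg hs.le (n + 1))
  exact (div_le_self (by positivity) (mod_cast Nat.factorial_pos _)).trans hbound

lemma isBigO (h : HasExpansionOn f a A (Icc 0 1)) (N : ℕ) :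
    (fun s => f s - ∑ k ∈ Finset.range N, a k * s ^ k) =O[𝓝[>] 0] fun s => s ^ N := by
  refine IsBigO.of_bound (A N) ?_
  filter_upwards [Ioc_mem_nhdsGT one_pos] with s hs
  rw [Real.norm_of_nonneg (pow_nonneg hs.1.le N)]
  exact h N s ⟨hs.1.le, hs.2⟩

lemma hasAsymptoticExpansion (h : HasExpansionOn f a A (Icc 0 1)) {F : ℝ → ℝ} {c : ℕ → ℝ} {r : ℝ}
    (hF : ∀ᶠ n in atTop, F n = c 0 + r * n⁻¹ * f n⁻¹) (hc : ∀ m, c (m + 1) = r * a m) :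
    HasAsymptoticExpansion F c := by
  intro N
  have hinv : Tendsto (fun n : ℝ => n⁻¹) atTop (𝓝[>] 0) := tendsto_inv_atTop_nhdsGT_zero
  have hbig : (fun n : ℝ => r * (f n⁻¹ - ∑ k ∈ Finset.range N, a k * n⁻¹ ^ k)) =O[atTop]
      fun n => n⁻¹ ^ N := ((h.isBigO N).comp_tendsto hinv).const_mul_left r
  have hsmall : (fun n : ℝ => n⁻¹) =o[atTop] fun _ => (1 : ℝ) :=
    (isLittleO_one_iff ℝ).2 tendsto_inv_atTop_zero
  refine (hsmall.mul_isBigO hbig).congr' ?_ (.of_forall fun n => by simp)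
  filter_upwards [hF] with n hn
  have hsum : ∑ i ∈ Finset.range N, c (i + 1) / n ^ (i + 1) =
      n⁻¹ * (r * ∑ i ∈ Finset.range N, a i * n⁻¹ ^ i) := by
    simp only [Finset.mul_sum]
    refine Finset.sum_congr rfl fun i _ => ?_
    rw [hc, div_eq_mul_inv, ← inv_pow, pow_succ]
    ring
  rw [hn, Finset.sum_range_succ', hsum, pow_zero]
  ring

end HasExpansionOn

lemma X_pow_dvd_of_eval_isBigO {𝕜 : Type*} [NormedField 𝕜] {l : Filter 𝕜} [l.NeBot]
    (hl : l ≤ 𝓝[≠] 0) {p : 𝕜[X]} {N : ℕ} (h : (fun x => p.eval x) =O[l] fun x => x ^ N) :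
    X ^ N ∣ p := by
  have hl0 : Tendsto id l (𝓝 0) := hl.trans nhdsWithin_le_nhds
  have hl1 : ∀ᶠ x in l, ‖x‖ ≤ 1 := by
    simpa using hl0.eventually (Metric.closedBall_mem_nhds (0 : 𝕜) one_pos)
  induction N with
  | zero => simp
  | succ N ih =>
    obtain ⟨q, rfl⟩ := ih (h.trans (.of_bound 1 (by
      filter_upwards [hl1] with x hx
      rw [pow_succ, norm_mul, one_mul]
      exact mul_le_of_le_one_right (norm_nonneg _) hx)))
    have hq : (fun x => q.eval x) =O[l] fun x => x := by
      refine (h.mul (isBigO_refl (fun x => (x ^ N)⁻¹) l)).congr' ?_ ?_ <;>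
        filter_upwards [hl self_mem_nhdsWithin] with x (hx : x ≠ 0)
      · simp only [eval_mul, eval_pow, eval_X]
        field_simp
      · rw [pow_succ']
        field_simp
    have hq0 : q.eval 0 = 0 := tendsto_nhds_unique
      ((q.continuous.tendsto 0).comp hl0) (hq.trans_tendsto hl0)
    obtain ⟨r, rfl⟩ := X_dvd_iff.2 (coeff_zero_eq_eval_zero q ▸ hq0)
    exact ⟨r, by ring⟩

/-! ### The softplus transform -/

/-- The softplus function evaluated at `-u`, equal to `-log (sigmoid u)`. -/
noncomputable def softplusNeg (u : ℝ) : ℝ :=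
  Real.log (1 + Real.exp (-u))

lemma exp_softplusNeg (u : ℝ) : Real.exp (softplusNeg u) = 1 + Real.exp (-u) :=
  Real.exp_log (by positivity)

lemma softplusNeg_nonneg (u : ℝ) : 0 ≤ softplusNeg u :=
  Real.log_nonneg (by linarith [Real.exp_pos (-u)])

lemma softplusNeg_le_exp_neg (u : ℝ) : softplusNeg u ≤ Real.exp (-u) := by
  simpa [softplusNeg] using Real.log_le_sub_one_of_pos (by positivity : 0 < 1 + Real.exp (-u))

lemma softplusNeg_le_one {u : ℝ} (hu : 0 ≤ u) : softplusNeg u ≤ 1 :=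
  (softplusNeg_le_exp_neg u).trans (Real.exp_le_one_iff.2 (neg_nonpos.2 hu))

@[fun_prop]
lemma continuous_softplusNeg : Continuous softplusNeg :=
  Continuous.log (by fun_prop) fun u => by positivity

/-- The coefficient of `ε ^ j` in `exp (ε * y) - 1`. -/
noncomputable def expSubOneCoeff (y : ℝ) (j : ℕ) : ℝ :=
  if j = 0 then 0 else y ^ j / j !

lemma abs_expSubOneCoeff_le {y : ℝ} (hy : |y| ≤ 1) (j : ℕ) : |expSubOneCoeff y j| ≤ |y| := by
  rcases eq_or_ne j 0 with rfl | hj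
  · simp [expSubOneCoeff]
  rw [expSubOneCoeff, if_neg hj, abs_div, abs_pow, Nat.abs_cast]
  exact (div_le_self (by positivity) (mod_cast j.factorial_pos)).trans
    (pow_le_of_le_one (abs_nonneg y) hy hj)

lemma hasExpansionOn_exp_sub_one {y : ℝ} (hy : |y| ≤ 1) :
    HasExpansionOn (fun ε => Real.exp (ε * y) - 1) (expSubOneCoeff y) (fun _ => 2 * |y|)
      (Icc 0 1) := by
  rintro N ε ⟨hε0, hε1⟩
  have hεy : |ε * y| = ε * |y| := by rw [abs_mul, abs_of_nonneg hε0]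
  have hle : |ε * y| ≤ 1 := hεy ▸ mul_le_one₀ hε1 (abs_nonneg y) hy
  rcases N with _ | N
  · have hεy_le : ε * |y| ≤ |y| := mul_le_of_le_one_left (abs_nonneg y) hε1
    simpa using (Real.abs_exp_sub_one_le hle).trans (by linarith)
  have hsum : ∑ j ∈ Finset.range (N + 1), expSubOneCoeff y j * ε ^ j + 1 =
      ∑ j ∈ Finset.range (N + 1), (ε * y) ^ j / j ! := by
    simp [Finset.sum_range_succ' _ N, expSubOneCoeff, mul_pow, div_mul_eq_mul_div, mul_comm (ε ^ _)]
  have hconst : ((N + 1).succ / ((N + 1)! * (N + 1 : ℕ)) : ℝ) ≤ 2 := by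
    have hfact : (1 : ℝ) ≤ (N + 1)! := mod_cast Nat.factorial_pos _
    rw [div_le_iff₀ (by positivity)]
    push_cast
    nlinarith [N.cast_nonneg (α := ℝ)]
  calc |Real.exp (ε * y) - 1 - ∑ j ∈ Finset.range (N + 1), expSubOneCoeff y j * ε ^ j|
      = |Real.exp (ε * y) - ∑ j ∈ Finset.range (N + 1), (ε * y) ^ j / j !| := by
        rw [← hsum, sub_sub, add_comm 1]
    _ ≤ |ε * y| ^ (N + 1) * ((N + 1).succ / ((N + 1)! * (N + 1 : ℕ))) :=
        Real.exp_bound hle N.succ_pos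
    _ ≤ |ε * y| ^ (N + 1) * 2 := by gcongr
    _ = 2 * |y| ^ (N + 1) * ε ^ (N + 1) := by rw [hεy, mul_pow]; ring
    _ ≤ 2 * |y| * ε ^ (N + 1) := by
        gcongr
        exact pow_le_of_le_one (abs_nonneg y) hy N.succ_ne_zero

/-- The integral transform to which both the power mean integral and the Beta function reduce. The
sign `σ` is `1` for the former and `-1` for the latter. -/
noncomputable def softplusTransform (σ : ℝ) (g : ℝ → ℝ) (ε : ℝ) : ℝ :=
  ∫ u in Ioi 0, (Real.exp (ε * (σ * softplusNeg u)) - 1) * g (ε * u)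

/-- The coefficient of `ε ^ m` in `softplusTransform σ g ε`, where `g s = ∑ b k * s ^ k`. -/
noncomputable def softplusCoeff (σ : ℝ) (b : ℕ → ℝ) (m : ℕ) : ℝ :=
  ∫ u in Ioi 0, ∑ j ∈ Finset.range (m + 1),
    expSubOneCoeff (σ * softplusNeg u) j * (b (m - j) * u ^ (m - j))

lemma integrableOn_exp_neg_mul_pow (k : ℕ) :
    IntegrableOn (fun u : ℝ => Real.exp (-u) * u ^ k) (Ioi 0) := by
  have := Real.GammaIntegral_convergent (s := k + 1) (by positivity)
  simpa using this

lemma hasExpansionOn_softplusTransform_integrand {σ u : ℝ} {g : ℝ → ℝ} {b C : ℕ → ℝ} (hσ : |σ| ≤ 1)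
    (hg : HasExpansionOn g b C (Ici 0)) (hu : 0 ≤ u) :
    HasExpansionOn (fun ε => (Real.exp (ε * (σ * softplusNeg u)) - 1) * g (ε * u))
      (fun m => ∑ j ∈ Finset.range (m + 1),
        expSubOneCoeff (σ * softplusNeg u) j * (b (m - j) * u ^ (m - j)))
      (fun N => ∑ j ∈ Finset.range N, C (N - j) * (Real.exp (-u) * u ^ (N - j)) +
        2 * C 0 * (Real.exp (-u) * u ^ 0)) (Icc 0 1) := by
  have hy : |σ * softplusNeg u| ≤ softplusNeg u := by
    rw [abs_mul, abs_of_nonneg (softplusNeg_nonneg u)]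
    exact mul_le_of_le_one_left (softplusNeg_nonneg u) hσ
  have hy_one := hy.trans (softplusNeg_le_one hu)
  have hy_exp := hy.trans (softplusNeg_le_exp_neg u)
  have hC : ∀ N, 0 ≤ C N := hg.const_nonneg (mem_Ici.2 zero_le_one)
  have hscaled := (hg.comp_mul_const hu).mono (T := Icc 0 1) (fun N => le_rfl)
    Icc_subset_Ici_self Icc_subset_Ici_self
  refine ((hasExpansionOn_exp_sub_one hy_one).mul hscaled Icc_subset_Ici_self).mono (fun N => ?_)
    subset_rfl Icc_subset_Ici_self
  refine add_le_add (Finset.sum_le_sum fun j _ => ?_) ?_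
  · have := (abs_expSubOneCoeff_le hy_one j).trans hy_exp
    have := hC (N - j)
    rw [mul_left_comm (C _)]
    gcongr
  · have := hC 0
    calc 2 * |σ * softplusNeg u| * (C 0 * u ^ 0) ≤ 2 * Real.exp (-u) * (C 0 * u ^ 0) := by gcongr
      _ = _ := by ring

lemma exists_hasExpansionOn_softplusTransform {σ : ℝ} {g : ℝ → ℝ} {b C : ℕ → ℝ} (hσ : |σ| ≤ 1)
    (hgc : Continuous g) (hg : HasExpansionOn g b C (Ici 0)) :
    ∃ D, HasExpansionOn (softplusTransform σ g) (softplusCoeff σ b) D (Icc 0 1) := by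
  refine ⟨_, HasExpansionOn.integral ((ae_restrict_mem measurableSet_Ioi).mono fun u hu =>
    hasExpansionOn_softplusTransform_integrand hσ hg (le_of_lt hu)) (by simp) (fun ε _ => ?_)
    (fun m => ?_) fun N => ?_⟩
  · exact Continuous.aestronglyMeasurable (by fun_prop)
  · have : Continuous fun u => ∑ j ∈ Finset.range (m + 1),
        expSubOneCoeff (σ * softplusNeg u) j * (b (m - j) * u ^ (m - j)) := by
      unfold expSubOneCoeff
      refine continuous_finsetSum _ fun j _ => ?_
      split_ifs <;> fun_prop
    exact this.aestronglyMeasurable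
  · exact (integrable_finsetSum _ fun j _ => (integrableOn_exp_neg_mul_pow _).const_mul _).add
      ((integrableOn_exp_neg_mul_pow 0).const_mul _)

lemma softplusCoeff_neg {σ r : ℝ} {b b' : ℕ → ℝ} {m : ℕ} (hb : ∀ k < m, b' k = r * (-1) ^ k * b k) :
    softplusCoeff (-σ) b' m = r * (-1) ^ m * softplusCoeff σ b m := by
  unfold softplusCoeff
  rw [← integral_const_mul]
  congr 1 with u
  rw [Finset.mul_sum]
  refine Finset.sum_congr rfl fun j hj => ?_
  rcases eq_or_ne j 0 with rfl | hj0
  · simp [expSubOneCoeff]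
  have hjm : j ≤ m := Finset.mem_range_succ_iff.1 hj
  have hsign : (-1 : ℝ) ^ m = (-1) ^ j * (-1) ^ (m - j) := (pow_mul_pow_sub _ hjm).symm
  rw [hb _ (by omega), expSubOneCoeff, expSubOneCoeff, if_neg hj0, if_neg hj0, hsign, neg_mul,
    neg_pow]
  ring

/-! ### The two kernels -/

/-- The kernel `y² (1 - y)`, where `y = sigmoid s`, of the power mean integral. -/
noncomputable def sigmoidKernel (s : ℝ) : ℝ :=
  Real.sigmoid s ^ 2 * (1 - Real.sigmoid s)

@[fun_prop]
lemma continuous_sigmoidKernel : Continuous sigmoidKernel :=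
  (continuous_sigmoid.pow 2).mul (continuous_const.sub continuous_sigmoid)

/-- The derivation of `ℝ[X]` given by the logistic equation `y' = y (1 - y)`. -/
noncomputable def logisticDeriv (p : ℝ[X]) : ℝ[X] :=
  derivative p * (X * (1 - X))

lemma iteratedDeriv_eval_sigmoid (k : ℕ) (p : ℝ[X]) :
    iteratedDeriv k (fun s => p.eval (Real.sigmoid s)) =
      fun s => (logisticDeriv^[k] p).eval (Real.sigmoid s) := by
  induction k generalizing p with
  | zero => simp
  | succ k ih =>
    have hderiv : deriv (fun s => p.eval (Real.sigmoid s)) =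
        fun s => (logisticDeriv p).eval (Real.sigmoid s) := by
      funext s
      have hcomp : HasDerivAt (fun s => p.eval (Real.sigmoid s)) _ s :=
        (p.hasDerivAt (Real.sigmoid s)).comp s (Real.hasDerivAt_sigmoid s)
      rw [hcomp.deriv]
      simp [logisticDeriv]
    rw [iteratedDeriv_succ', hderiv, ih, Function.iterate_succ_apply]

lemma iteratedDeriv_sigmoidKernel (k : ℕ) (s : ℝ) :
    iteratedDeriv k sigmoidKernel s =
      (logisticDeriv^[k] (X ^ 2 * (1 - X))).eval (Real.sigmoid s) := by
  rw [← congrFun (iteratedDeriv_eval_sigmoid k _) s]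
  congr 1 with t
  simp [sigmoidKernel]

lemma exists_hasExpansionOn_sigmoidKernel :
    ∃ C, HasExpansionOn sigmoidKernel (taylorCoeff sigmoidKernel) C (Ici 0) := by
  have hbound : ∀ N, ∃ C : ℝ, ∀ y ∈ Icc (0 : ℝ) 1,
      ‖(logisticDeriv^[N] (X ^ 2 * (1 - X))).eval y‖ ≤ C := fun N =>
    isCompact_Icc.exists_bound_of_continuousOn (Polynomial.continuous _).continuousOn
  choose C hC using hbound
  have hsmooth : ContDiff ℝ ∞ sigmoidKernel := by
    unfold sigmoidKernel
    have := contDiff_sigmoid.of_le (m := ∞) le_top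
    fun_prop
  refine ⟨C, .of_contDiff hsmooth fun N s _ => ?_⟩
  rw [iteratedDeriv_sigmoidKernel]
  exact hC N _ ⟨Real.sigmoid_nonneg s, Real.sigmoid_le_one s⟩

/-- The primitive cube root of unity `exp (2πi/3)`. -/
noncomputable def cubeRoot : ℂ :=
  ⟨-1 / 2, √3 / 2⟩

lemma cubeRoot_re : cubeRoot.re = -1 / 2 := rfl

lemma cubeRoot_add_conj : cubeRoot + (starRingEnd ℂ) cubeRoot = -1 := by
  rw [Complex.add_conj, cubeRoot_re]
  norm_num

lemma cubeRoot_mul_conj : cubeRoot * (starRingEnd ℂ) cubeRoot = 1 := by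
  have hsqrt := Real.mul_self_sqrt (show (0 : ℝ) ≤ 3 by norm_num)
  rw [Complex.mul_conj, Complex.normSq_apply, Complex.ofReal_eq_one]
  simp only [cubeRoot]
  linarith

lemma norm_cubeRoot : ‖cubeRoot‖ = 1 := by
  have hsq := cubeRoot_mul_conj
  rw [Complex.mul_conj, Complex.normSq_eq_norm_sq, Complex.ofReal_eq_one] at hsq
  exact (pow_eq_one_iff_of_nonneg (norm_nonneg _) two_ne_zero).1 hsq

lemma cubeRoot_sq : cubeRoot ^ 2 = -1 - cubeRoot := by
  linear_combination cubeRoot * cubeRoot_add_conj - cubeRoot_mul_conj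

lemma cubeRoot_cube : cubeRoot ^ 3 = 1 := by
  linear_combination (cubeRoot - 1) * cubeRoot_sq

lemma iteratedDeriv_re_mul_cexp (k : ℕ) (w z : ℂ) :
    iteratedDeriv k (fun s : ℝ => (w * Complex.exp (z * s)).re) =
      fun s : ℝ => (w * z ^ k * Complex.exp (z * s)).re := by
  induction k generalizing w with
  | zero => simp
  | succ k ih =>
    have hderiv : deriv (fun s : ℝ => (w * Complex.exp (z * s)).re) =
        fun s : ℝ => (w * z * Complex.exp (z * s)).re := by
      funext s
      have hlin : HasDerivAt (fun s : ℝ => z * (s : ℂ)) z s := by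
        simpa using (Complex.ofRealCLM.hasDerivAt (x := s)).const_mul z
      have hexp : HasDerivAt (fun s : ℝ => w * Complex.exp (z * s))
          (w * z * Complex.exp (z * s)) s :=
        (hlin.cexp.const_mul w).congr_deriv (by ring)
      exact (Complex.reCLM.hasFDerivAt.comp_hasDerivAt s hexp).deriv
    rw [iteratedDeriv_succ', hderiv, ih]
    simp only [pow_succ', mul_assoc]

/-- The kernel `Re exp (ω s)`, where `ω` is a primitive cube root of unity. Its transform is a Beta
function, and its first four Taylor coefficients are those of `sigmoidKernel` up to sign and
scale. -/
noncomputable def cubeRootKernel (s : ℝ) : ℝ :=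
  (Complex.exp (cubeRoot * s)).re

@[fun_prop]
lemma continuous_cubeRootKernel : Continuous cubeRootKernel := by
  unfold cubeRootKernel
  fun_prop

lemma iteratedDeriv_cubeRootKernel (k : ℕ) (s : ℝ) :
    iteratedDeriv k cubeRootKernel s = (cubeRoot ^ k * Complex.exp (cubeRoot * s)).re := by
  have h := congrFun (iteratedDeriv_re_mul_cexp k 1 cubeRoot) s
  simp only [one_mul] at h
  exact h

lemma hasExpansionOn_cubeRootKernel :
    HasExpansionOn cubeRootKernel (taylorCoeff cubeRootKernel) (fun _ => 1) (Ici 0) := by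
  have hsmooth : ContDiff ℝ ∞ cubeRootKernel :=
    Complex.reCLM.contDiff.comp (contDiff_const.mul Complex.ofRealCLM.contDiff).cexp
  refine .of_contDiff hsmooth fun N s hs => ?_
  rw [iteratedDeriv_cubeRootKernel]
  refine (Complex.abs_re_le_norm _).trans ?_
  rw [norm_mul, norm_pow, norm_cubeRoot, one_pow, one_mul, Complex.norm_exp,
    Complex.re_mul_ofReal, cubeRoot_re, Real.exp_le_one_iff]
  linarith

lemma taylorCoeff_sigmoidKernel {k : ℕ} (hk : k < 4) :
    taylorCoeff sigmoidKernel k = 1 / 8 * (-1) ^ k * taylorCoeff cubeRootKernel k := by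
  simp only [taylorCoeff, iteratedDeriv_sigmoidKernel, iteratedDeriv_cubeRootKernel,
    Real.sigmoid_zero]
  interval_cases k <;>
    simp [logisticDeriv, cubeRoot_sq, cubeRoot_cube, cubeRoot_re, Nat.factorial] <;> norm_num

/-! ### The power mean integral -/

lemma image_sigmoid_Ioi {ε : ℝ} (hε : 0 < ε) :
    (fun u => Real.sigmoid (ε * u)) '' Ioi 0 = Ioo 2⁻¹ 1 := by
  ext x
  constructor
  · rintro ⟨u, hu, rfl⟩
    exact ⟨Real.sigmoid_zero ▸ Real.sigmoid_lt (mul_pos hε hu), Real.sigmoid_lt_one _⟩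
  · rintro ⟨hx, hx1⟩
    obtain ⟨s, rfl⟩ : x ∈ range Real.sigmoid :=
      Real.range_sigmoid ▸ ⟨(inv_pos.2 two_pos).trans hx, hx1⟩
    have hs : 0 < s := Real.sigmoid_lt_iff.1 (Real.sigmoid_zero.symm ▸ hx)
    exact ⟨s / ε, div_pos hs hε, congrArg Real.sigmoid (mul_div_cancel₀ s hε.ne')⟩

section NormedSpace

variable {E : Type*} [NormedAddCommGroup E] [NormedSpace ℝ E]

lemma integral_Ioo_eq_integral_sigmoid {ε : ℝ} (hε : 0 < ε) (F : ℝ → E) :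
    ∫ x in Ioo 2⁻¹ 1, F x = ∫ u in Ioi (0 : ℝ),
      (ε * (Real.sigmoid (ε * u) * (1 - Real.sigmoid (ε * u)))) • F (Real.sigmoid (ε * u)) := by
  have hderiv : ∀ u : ℝ, HasDerivAt (fun u => Real.sigmoid (ε * u))
      (ε * (Real.sigmoid (ε * u) * (1 - Real.sigmoid (ε * u)))) u := fun u => by
    have h := (Real.hasDerivAt_sigmoid (ε * u)).comp u ((hasDerivAt_id u).const_mul ε)
    rwa [mul_one, mul_comm] at h
  have hinj : InjOn (fun u => Real.sigmoid (ε * u)) (Ioi 0) := fun u _ v _ huv =>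
    mul_left_cancel₀ hε.ne' (Real.sigmoid_injective huv)
  rw [← image_sigmoid_Ioi hε, integral_image_eq_integral_abs_deriv_smul measurableSet_Ioi
    (fun u _ => (hderiv u).hasDerivWithinAt) hinj]
  refine setIntegral_congr_fun measurableSet_Ioi fun u _ => ?_
  have hpos := Real.sigmoid_nonneg (ε * u)
  have hlt := sub_nonneg.2 (Real.sigmoid_le_one (ε * u))
  simp only [abs_of_nonneg (mul_nonneg hε.le (mul_nonneg hpos hlt))]

lemma integral_zero_one_eq_integral_Ioo {f : ℝ → E} (hf : IntervalIntegrable f volume 0 1) :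
    ∫ x in (0 : ℝ)..1, f x = ∫ x in Ioo 2⁻¹ 1, (f x + f (1 - x)) := by
  have hhalf : (2⁻¹ : ℝ) ∈ uIcc 0 1 := by
    rw [uIcc_of_le zero_le_one]
    norm_num
  have hleft : IntervalIntegrable f volume 0 2⁻¹ :=
    hf.mono_set (uIcc_subset_uIcc_left hhalf)
  have hright : IntervalIntegrable f volume 2⁻¹ 1 :=
    hf.mono_set (uIcc_subset_uIcc_right hhalf)
  have hreflect : IntervalIntegrable (fun x => f (1 - x)) volume 2⁻¹ 1 := by
    have := (hleft.comp_sub_left 1).symm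
    norm_num at this ⊢
    exact this
  rw [← integral_Ioc_eq_integral_Ioo, ← intervalIntegral.integral_of_le (by norm_num),
    intervalIntegral.integral_add hright hreflect, intervalIntegral.integral_comp_sub_left,
    ← intervalIntegral.integral_add_adjacent_intervals hleft hright, add_comm]
  norm_num

end NormedSpace

lemma rpow_add_rpow_one_sub_sigmoid {n : ℝ} (hn : n ≠ 0) (u : ℝ) :
    (Real.sigmoid (n⁻¹ * u) ^ n + (1 - Real.sigmoid (n⁻¹ * u)) ^ n) ^ (1 / n) =
      Real.sigmoid (n⁻¹ * u) * Real.exp (n⁻¹ * softplusNeg u) := by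
  set y := Real.sigmoid (n⁻¹ * u)
  have hy : 0 ≤ y := Real.sigmoid_nonneg _
  have hsub : (1 - y) ^ n = y ^ n * Real.exp (-u) := by
    rw [← Real.sigmoid_neg, ← Real.sigmoid_mul_rexp_neg, Real.mul_rpow hy (Real.exp_pos _).le,
      ← Real.exp_mul]
    field_simp
  calc (y ^ n + (1 - y) ^ n) ^ (1 / n) = (y ^ n * Real.exp (softplusNeg u)) ^ (1 / n) := by
        rw [hsub, exp_softplusNeg, mul_add, mul_one]
    _ = y * Real.exp (n⁻¹ * softplusNeg u) := by
        rw [Real.mul_rpow (by positivity) (Real.exp_pos _).le, ← Real.rpow_mul hy,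
          mul_one_div_cancel hn, Real.rpow_one, ← Real.exp_mul, one_div, mul_comm _ n⁻¹]

lemma powerMeanIntegral_eq {n : ℝ} (hn : 0 < n) :
    powerMeanIntegral n = 3 / 4 + 2 * n⁻¹ * softplusTransform 1 sigmoidKernel n⁻¹ := by
  set h : ℝ → ℝ := fun x => (x ^ n + (1 - x) ^ n) ^ (1 / n)
  have hcont : Continuous h := by
    refine ((continuous_id.rpow_const fun _ => .inr hn.le).add ?_).rpow_const
      fun _ => .inr (by positivity)
    exact (continuous_const.sub continuous_id).rpow_const fun _ => .inr hn.le
  have hsymm : ∀ x, h (1 - x) = h x := fun x => by simp [h, add_comm]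
  have hintegrable : ∀ {f : ℝ → ℝ}, Continuous f → IntegrableOn f (Ioo 2⁻¹ 1) := fun hf =>
    (hf.integrableOn_Icc).mono_set Ioo_subset_Icc_self
  have hlimit : ∫ x in Ioo (2⁻¹ : ℝ) 1, 2 * x = 3 / 4 := by
    rw [← integral_Ioc_eq_integral_Ioo, ← intervalIntegral.integral_of_le (by norm_num),
      intervalIntegral.integral_const_mul, integral_id]
    norm_num
  have hcorrection : ∫ x in Ioo 2⁻¹ 1, 2 * (h x - x) =
      2 * n⁻¹ * softplusTransform 1 sigmoidKernel n⁻¹ := by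
    rw [integral_Ioo_eq_integral_sigmoid (inv_pos.2 hn), softplusTransform, ← integral_const_mul]
    congr 1 with u
    simp only [h, rpow_add_rpow_one_sub_sigmoid hn.ne', sigmoidKernel, smul_eq_mul, one_mul]
    ring
  calc powerMeanIntegral n = ∫ x in Ioo 2⁻¹ 1, (h x + h (1 - x)) :=
        integral_zero_one_eq_integral_Ioo (hcont.intervalIntegrable 0 1)
    _ = ∫ x in Ioo 2⁻¹ 1, (2 * x + 2 * (h x - x)) := by
        simp only [hsymm]
        congr 1 with x
        ring
    _ = _ := by
        rw [integral_add (hintegrable (by fun_prop)) (hintegrable (by fun_prop)), hlimit,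
          hcorrection]

/-! ### The Beta function as a softplus transform -/

lemma ofReal_sigmoid_cpow (s : ℂ) (u : ℝ) :
    (Real.sigmoid u : ℂ) ^ s = Complex.exp (-(softplusNeg u) * s) := by
  have hpos := Real.sigmoid_pos u
  rw [Complex.cpow_def_of_ne_zero (Complex.ofReal_ne_zero.2 hpos.ne'), ← Complex.ofReal_log hpos.le,
    Real.sigmoid_def, Real.log_inv, Complex.ofReal_neg, softplusNeg]

lemma one_sub_ofReal_sigmoid_cpow (s : ℂ) (u : ℝ) :
    (1 - (Real.sigmoid u : ℂ)) ^ s = Complex.exp (-(softplusNeg u) * s - u * s) := by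
  have hreflect : softplusNeg (-u) = softplusNeg u + u := by
    rw [← Real.exp_eq_exp, Real.exp_add, exp_softplusNeg, exp_softplusNeg, add_mul, ← Real.exp_add]
    simp [add_comm]
  rw [← Complex.ofReal_one, ← Complex.ofReal_sub, ← Real.sigmoid_neg, ofReal_sigmoid_cpow,
    hreflect]
  push_cast
  ring_nf

section Beta

variable {p q : ℂ}

lemma betaIntegral_eq_integral_Ioi (hp : 0 < p.re) (hq : 0 < q.re) :
    Complex.betaIntegral p q = ∫ u : ℝ in Ioi 0,
      Complex.exp (-(p + q) * softplusNeg u) * (Complex.exp (-p * u) + Complex.exp (-q * u)) := by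
  rw [Complex.betaIntegral, integral_zero_one_eq_integral_Ioo
    (Complex.betaIntegral_convergent hp hq), integral_Ioo_eq_integral_sigmoid one_pos]
  congr 1 with u
  have hy : (Real.sigmoid u : ℂ) ≠ 0 := Complex.ofReal_ne_zero.2 (Real.sigmoid_pos u).ne'
  have hy' : 1 - (Real.sigmoid u : ℂ) ≠ 0 := by
    rw [← Complex.ofReal_one, ← Complex.ofReal_sub, Complex.ofReal_ne_zero]
    exact (sub_pos.2 (Real.sigmoid_lt_one u)).ne'
  have hswap : ∀ s t : ℂ, (Real.sigmoid u : ℂ) * (1 - Real.sigmoid u) *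
      ((Real.sigmoid u : ℂ) ^ (s - 1) * (1 - (Real.sigmoid u : ℂ)) ^ (t - 1)) =
        Complex.exp (-(s + t) * softplusNeg u) * Complex.exp (-t * u) := fun s t => by
    rw [Complex.cpow_sub _ _ hy, Complex.cpow_sub _ _ hy', Complex.cpow_one, Complex.cpow_one,
      mul_mul_mul_comm, mul_div_cancel₀ _ hy, mul_div_cancel₀ _ hy', ofReal_sigmoid_cpow,
      one_sub_ofReal_sigmoid_cpow, ← Complex.exp_add, ← Complex.exp_add]
    ring_nf
  simp only [one_mul, Complex.real_smul, Complex.ofReal_mul, Complex.ofReal_sub, Complex.ofReal_one,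
    sub_sub_cancel, mul_add]
  rw [hswap, mul_comm (_ ^ (p - 1)), hswap, add_comm q p, add_comm]

lemma integrableOn_exp_softplusNeg_mul {s : ℂ} (hs : 0 ≤ s.re) {f : ℝ → ℂ}
    (hf : IntegrableOn f (Ioi 0)) :
    IntegrableOn (fun u : ℝ => Complex.exp (-s * softplusNeg u) * f u) (Ioi 0) := by
  refine hf.bdd_mul (c := 1) (Continuous.aestronglyMeasurable (by fun_prop))
    (.of_forall fun u => ?_)
  rw [Complex.norm_exp, Complex.re_mul_ofReal, Complex.neg_re, Real.exp_le_one_iff, neg_mul,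
    neg_nonpos]
  exact mul_nonneg hs (softplusNeg_nonneg u)

lemma betaIntegral_eq_inv_add_inv_add_integral (hp : 0 < p.re) (hq : 0 < q.re) :
    Complex.betaIntegral p q = p⁻¹ + q⁻¹ + ∫ u : ℝ in Ioi 0,
      (Complex.exp (-(p + q) * softplusNeg u) - 1) *
        (Complex.exp (-p * u) + Complex.exp (-q * u)) := by
  have hintegrable : ∀ {s : ℂ}, 0 < s.re →
      IntegrableOn (fun u : ℝ => Complex.exp (-s * u)) (Ioi 0) := fun hs =>
    integrableOn_exp_mul_complex_Ioi (by simpa using hs) 0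
  have hvalue : ∀ {s : ℂ}, 0 < s.re → ∫ u : ℝ in Ioi 0, Complex.exp (-s * u) = s⁻¹ := fun hs => by
    rw [integral_exp_mul_complex_Ioi (by simpa using hs)]
    simp [neg_div_neg_eq]
  have hsum : IntegrableOn (fun u : ℝ => Complex.exp (-p * u) + Complex.exp (-q * u)) (Ioi 0) :=
    (hintegrable hp).add (hintegrable hq)
  simp only [sub_mul, one_mul]
  rw [betaIntegral_eq_integral_Ioi hp hq, integral_sub
    (integrableOn_exp_softplusNeg_mul (by simpa using (add_pos hp hq).le) hsum) hsum,
    integral_add (hintegrable hp) (hintegrable hq), hvalue hp, hvalue hq]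
  ring

lemma GammaSeq_eq_cpow_div (s : ℂ) (n : ℕ) :
    Complex.GammaSeq s n = n ^ s / (s * ∏ j ∈ Finset.range n, (1 + s / (j + 1))) := by
  have hfactor : ∏ j ∈ Finset.range n, (s + (j + 1 : ℕ)) =
      n ! * ∏ j ∈ Finset.range n, (1 + s / (j + 1)) := by
    rw [← Finset.prod_range_add_one_eq_factorial, Nat.cast_prod, ← Finset.prod_mul_distrib]
    refine Finset.prod_congr rfl fun j _ => ?_
    have hj : (j + 1 : ℂ) ≠ 0 := Nat.cast_add_one_ne_zero j
    push_cast
    field_simp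
    ring
  have hfactorial : (n ! : ℂ) ≠ 0 := mod_cast n.factorial_ne_zero
  rw [Complex.GammaSeq, Finset.prod_range_succ', hfactor, Nat.cast_zero, add_zero, mul_assoc,
    mul_comm _ (n ! : ℂ), mul_div_mul_left _ _ hfactorial, mul_comm s]

lemma tendsto_prod_div_betaIntegral (hp : 0 < p.re) (hq : 0 < q.re) :
    Tendsto (fun n : ℕ => ∏ j ∈ Finset.range n,
      (1 + (p + q) / (j + 1)) / ((1 + p / (j + 1)) * (1 + q / (j + 1))))
      atTop (𝓝 (p * q / (p + q) * Complex.betaIntegral p q)) := by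
  have hre_add : 0 < (p + q).re := by simpa using add_pos hp hq
  have hne : ∀ {s : ℂ}, 0 < s.re → s ≠ 0 := fun hs h => by simp [h] at hs
  have hp0 := hne hp
  have hq0 := hne hq
  have hpq0 := hne hre_add
  have hΓ := Complex.Gamma_ne_zero_of_re_pos hre_add
  have hbeta : Complex.betaIntegral p q =
      Complex.Gamma p * Complex.Gamma q / Complex.Gamma (p + q) := by
    rw [Complex.Gamma_mul_Gamma_eq_betaIntegral hp hq, mul_div_cancel_left₀ _ hΓ]
  rw [hbeta]
  refine ((((Complex.GammaSeq_tendsto_Gamma p).mul (Complex.GammaSeq_tendsto_Gamma q)).div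
    (Complex.GammaSeq_tendsto_Gamma (p + q)) hΓ).const_mul (p * q / (p + q))).congr' ?_
  filter_upwards [eventually_ne_atTop 0] with n hn
  have hn0 : (n : ℂ) ≠ 0 := Nat.cast_ne_zero.2 hn
  have hpow : ∀ s : ℂ, (n : ℂ) ^ s ≠ 0 := fun s => by simp [Complex.cpow_eq_zero_iff, hn]
  rw [Finset.prod_div_distrib, Finset.prod_mul_distrib, Pi.div_apply]
  simp only [GammaSeq_eq_cpow_div, Complex.cpow_add _ _ hn0]
  field_simp [hpow]

end Beta

lemma neg_cubeRoot_mul_re_pos {ε : ℝ} (hε : 0 < ε) : 0 < (-cubeRoot * ε).re := by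
  rw [Complex.re_mul_ofReal, Complex.neg_re, cubeRoot_re]
  linarith

lemma neg_conj_cubeRoot_mul_re_pos {ε : ℝ} (hε : 0 < ε) :
    0 < (-(starRingEnd ℂ) cubeRoot * ε).re := by
  rw [← map_neg, Complex.re_mul_ofReal, Complex.conj_re, ← Complex.re_mul_ofReal]
  exact neg_cubeRoot_mul_re_pos hε

lemma neg_cubeRoot_mul_add_neg_conj (z : ℂ) :
    -cubeRoot * z + -(starRingEnd ℂ) cubeRoot * z = z := by
  linear_combination (-z) * cubeRoot_add_conj

lemma betaIntegral_cubeRoot {ε : ℝ} (hε : 0 < ε) :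
    ε * Complex.betaIntegral (-cubeRoot * ε) (-(starRingEnd ℂ) cubeRoot * ε) =
      (1 + 2 * ε * softplusTransform (-1) cubeRootKernel ε : ℝ) := by
  have hω : cubeRoot ≠ 0 := left_ne_zero_of_mul_eq_one cubeRoot_mul_conj
  have hω' : (starRingEnd ℂ) cubeRoot ≠ 0 := right_ne_zero_of_mul_eq_one cubeRoot_mul_conj
  have hε0 : (ε : ℂ) ≠ 0 := Complex.ofReal_ne_zero.2 hε.ne'
  have hinv : (-cubeRoot * ε)⁻¹ + (-(starRingEnd ℂ) cubeRoot * ε)⁻¹ = (ε : ℂ)⁻¹ := by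
    field_simp
    linear_combination -cubeRoot_add_conj - cubeRoot_mul_conj
  have hkernel : ∀ u : ℝ, Complex.exp (-(-cubeRoot * ε) * u) +
      Complex.exp (-(-(starRingEnd ℂ) cubeRoot * ε) * u) =
        (2 * cubeRootKernel (ε * u) : ℝ) := fun u => by
    rw [cubeRootKernel, ← Complex.add_conj, ← Complex.exp_conj]
    simp [mul_assoc]
  rw [betaIntegral_eq_inv_add_inv_add_integral (neg_cubeRoot_mul_re_pos hε)
    (neg_conj_cubeRoot_mul_re_pos hε), neg_cubeRoot_mul_add_neg_conj, hinv, mul_add,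
    mul_inv_cancel₀ hε0]
  simp only [hkernel]
  rw [softplusTransform, ← integral_const_mul, ← integral_const_mul]
  push_cast
  rw [← integral_complex_ofReal]
  congr 2 with u
  push_cast
  ring_nf

lemma one_add_div_mul_cubeRoot {x : ℝ} (hx : x ≠ 1) :
    (1 + x) / ((1 + -cubeRoot * x) * (1 + -(starRingEnd ℂ) cubeRoot * x)) =
      ((1 - x ^ 2) / (1 - x ^ 3) : ℝ) := by
  have hroots : (1 + -cubeRoot * x) * (1 + -(starRingEnd ℂ) cubeRoot * x) =
      (1 + x + x ^ 2 : ℝ) := by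
    push_cast
    linear_combination (x : ℂ) ^ 2 * cubeRoot_mul_conj - (x : ℂ) * cubeRoot_add_conj
  have hsq : 1 - x ^ 2 = (1 - x) * (1 + x) := by ring
  have hcube : 1 - x ^ 3 = (1 - x) * (1 + x + x ^ 2) := by ring
  rw [hroots, hsq, hcube, mul_div_mul_left _ _ (sub_ne_zero.2 hx.symm)]
  push_cast
  rfl

lemma tendsto_prod_one_sub_sq_div_one_sub_cube {ε : ℝ} (hε : 0 < ε) (hε1 : ε < 1) :
    Tendsto (fun n : ℕ => ∏ j ∈ Finset.range n,
      (1 - (ε / (j + 1)) ^ 2) / (1 - (ε / (j + 1)) ^ 3))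
      atTop (𝓝 (1 + 2 * ε * softplusTransform (-1) cubeRootKernel ε)) := by
  rw [← tendsto_ofReal_iff, ← betaIntegral_cubeRoot hε]
  have hε0 : (ε : ℂ) ≠ 0 := Complex.ofReal_ne_zero.2 hε.ne'
  have hscale : -cubeRoot * ε * (-(starRingEnd ℂ) cubeRoot * ε) / ε = (ε : ℂ) := by
    field_simp
    linear_combination cubeRoot_mul_conj
  have h := tendsto_prod_div_betaIntegral (neg_cubeRoot_mul_re_pos hε)
    (neg_conj_cubeRoot_mul_re_pos hε)
  rw [neg_cubeRoot_mul_add_neg_conj, hscale] at h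
  refine h.congr fun n => ?_
  rw [Complex.ofReal_prod]
  refine Finset.prod_congr rfl fun j _ => ?_
  have hlt : ε / (j + 1) < 1 :=
    (div_lt_one (by positivity)).2 (hε1.trans_le (by simp))
  have hfactor := one_add_div_mul_cubeRoot hlt.ne
  push_cast at hfactor ⊢
  simpa only [mul_div_assoc] using hfactor

/-! ### Logarithms of infinite products and zeta values -/

section LogProduct

variable {ι : Type*} {a : ι → ℝ}

lemma summable_abs_pow_succ (ha : Summable a) (m : ℕ) : Summable fun j => |a j| ^ (m + 1) := by
  refine .of_norm_bounded (ha.abs.mul_left ((∑' j, |a j|) ^ m)) fun j => ?_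
  rw [Real.norm_of_nonneg (by positivity), pow_succ]
  gcongr
  exact ha.abs.le_tsum j fun _ _ => abs_nonneg _

lemma tsum_log_one_sub_mul_add_sum_isBigO (ha : Summable a) (M : ℕ) :
    (fun z => ∑' j, Real.log (1 - z * a j) +
      ∑ i ∈ Finset.range M, (∑' j, a j ^ (i + 1)) * z ^ (i + 1) / (i + 1))
      =O[𝓝 0] fun z => z ^ (M + 1) := by
  have hsmall : ∀ᶠ z in 𝓝 (0 : ℝ), |z| * ∑' j, |a j| < 1 / 2 :=
    (continuous_abs.mul_const _).continuousAt.eventually_lt_const (by simp)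
  refine .of_bound (2 * ∑' j, |a j| ^ (M + 1)) ?_
  filter_upwards [hsmall] with z hz
  have hterm : ∀ j, |z * a j| ≤ 1 / 2 := fun j => by
    rw [abs_mul]
    exact (mul_le_mul_of_nonneg_left (ha.abs.le_tsum j fun _ _ => abs_nonneg _)
      (abs_nonneg z)).trans hz.le
  have hlog : Summable fun j => Real.log (1 - z * a j) := by
    simpa only [sub_eq_add_neg] using
      Real.summable_log_one_add_of_summable (ha.mul_left z).neg
  have hpow : ∀ i ∈ Finset.range M, HasSum (fun j => (z * a j) ^ (i + 1) / (i + 1))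
      ((∑' j, a j ^ (i + 1)) * z ^ (i + 1) / (i + 1)) := fun i _ => by
    have hi : Summable fun j => a j ^ (i + 1) :=
      .of_abs (by simpa only [abs_pow] using summable_abs_pow_succ ha i)
    simpa only [mul_pow, mul_comm] using (hi.hasSum.mul_right (z ^ (i + 1))).div_const (i + 1 : ℝ)
  rw [← (hlog.hasSum.add (hasSum_sum hpow)).tsum_eq]
  refine tsum_of_norm_bounded (g := fun j => 2 * |a j| ^ (M + 1) * ‖z ^ (M + 1)‖)
    (((summable_abs_pow_succ ha M).hasSum.mul_left 2).mul_right _) fun j => ?_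
  calc |Real.log (1 - z * a j) + ∑ i ∈ Finset.range M, (z * a j) ^ (i + 1) / (i + 1)|
      ≤ |z * a j| ^ (M + 1) / (1 - |z * a j|) := by
        rw [add_comm]
        exact Real.abs_log_sub_add_sum_range_le ((hterm j).trans_lt (by norm_num)) M
    _ ≤ |z * a j| ^ (M + 1) / (1 / 2) := by
        gcongr
        linarith [hterm j]
    _ = 2 * |a j| ^ (M + 1) * ‖z ^ (M + 1)‖ := by
        rw [abs_mul, norm_pow, Real.norm_eq_abs]
        ring

lemma hasProd_one_sub_mul (ha : Summable a) {z : ℝ} (hz : ∀ j, z * a j < 1) :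
    HasProd (fun j => 1 - z * a j) (Real.exp (∑' j, Real.log (1 - z * a j))) := by
  refine Real.hasProd_of_hasSum_log (fun j => sub_pos.2 (hz j)) (Summable.hasSum ?_)
  simpa only [sub_eq_add_neg] using Real.summable_log_one_add_of_summable (ha.mul_left z).neg

end LogProduct

/-- The zeta value `ζ(k)` as a real number, for a natural number `k ≥ 2`. -/
noncomputable def zetaSum (k : ℕ) : ℝ :=
  ∑' j : ℕ, ((j + 1 : ℝ) ^ k)⁻¹

lemma summable_inv_add_one_pow {k : ℕ} (hk : 1 < k) : Summable fun j : ℕ => ((j + 1 : ℝ) ^ k)⁻¹ :=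
  mod_cast (summable_nat_add_iff 1).2 (Real.summable_nat_pow_inv.2 hk)

lemma ofReal_zetaSum {k : ℕ} (hk : 1 < k) : (zetaSum k : ℂ) = riemannZeta k := by
  rw [zeta_eq_tsum_one_div_nat_add_one_cpow (by simpa using hk), zetaSum, Complex.ofReal_tsum]
  simp

lemma zetaSum_two : zetaSum 2 = Real.pi ^ 2 / 6 := by
  have h := ofReal_zetaSum one_lt_two
  rw [Nat.cast_ofNat, riemannZeta_two] at h
  exact_mod_cast h

lemma zetaSum_four : zetaSum 4 = Real.pi ^ 4 / 90 := by
  have h := ofReal_zetaSum (k := 4) (by norm_num)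
  rw [Nat.cast_ofNat, riemannZeta_four] at h
  exact_mod_cast h

/-- The logarithm of `∏_{j ≥ 1} (1 - (x / j) ^ k)`, a generating function of the zeta values at
multiples of `k`. -/
noncomputable def logZetaProd (k : ℕ) (x : ℝ) : ℝ :=
  ∑' j : ℕ, Real.log (1 - (x / (j + 1)) ^ k)

lemma logZetaProd_add_sum_isBigO {k : ℕ} (hk : 1 < k) (M : ℕ) :
    (fun x => logZetaProd k x +
      ∑ i ∈ Finset.range M, zetaSum (k * (i + 1)) * x ^ (k * (i + 1)) / (i + 1))
      =O[𝓝 0] fun x => x ^ (k * (M + 1)) := by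
  have hpow : Tendsto (fun x : ℝ => x ^ k) (𝓝 0) (𝓝 0) :=
    (continuous_pow k).tendsto' _ _ (zero_pow (by lia))
  simpa only [Function.comp_def, logZetaProd, zetaSum, pow_mul, inv_pow,
    ← div_eq_mul_inv, ← div_pow] using
    (tsum_log_one_sub_mul_add_sum_isBigO (summable_inv_add_one_pow hk) M).comp_tendsto hpow

lemma tendsto_prod_one_sub_div_pow {k : ℕ} (hk : 1 < k) {x : ℝ} (hx : 0 ≤ x) (hx1 : x < 1) :
    Tendsto (fun n : ℕ => ∏ j ∈ Finset.range n, (1 - (x / (j + 1)) ^ k)) atTop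
      (𝓝 (Real.exp (logZetaProd k x))) := by
  have hlt : ∀ j : ℕ, x ^ k * ((j + 1 : ℝ) ^ k)⁻¹ < 1 := fun j => by
    rw [← div_eq_mul_inv, ← div_pow]
    exact pow_lt_one₀ (by positivity) ((div_lt_one (by positivity)).2 (hx1.trans_le (by simp)))
      (by lia)
  simpa only [logZetaProd, ← div_eq_mul_inv, ← div_pow] using
    (hasProd_one_sub_mul (summable_inv_add_one_pow hk) hlt).tendsto_prod_nat

lemma one_add_two_mul_softplusTransform_cubeRootKernel {ε : ℝ} (hε : 0 < ε) (hε1 : ε < 1) :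
    1 + 2 * ε * softplusTransform (-1) cubeRootKernel ε =
      Real.exp (logZetaProd 2 ε - logZetaProd 3 ε) := by
  refine tendsto_nhds_unique (tendsto_prod_one_sub_sq_div_one_sub_cube hε hε1) ?_
  simp only [Finset.prod_div_distrib, Real.exp_sub]
  exact (tendsto_prod_one_sub_div_pow (by norm_num) hε.le hε1).div
    (tendsto_prod_one_sub_div_pow (by norm_num) hε.le hε1) (Real.exp_ne_zero _)

lemma logZetaProd_two_sub_three_isBigO :
    (fun x => logZetaProd 2 x - logZetaProd 3 x -
      (-zetaSum 2 * x ^ 2 + zetaSum 3 * x ^ 3 - zetaSum 4 / 2 * x ^ 4))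
      =O[𝓝 0] fun x => x ^ 6 := by
  refine ((logZetaProd_add_sum_isBigO one_lt_two 2).sub
    (logZetaProd_add_sum_isBigO (k := 3) (by norm_num) 1)).congr_left fun x => ?_
  norm_num [Finset.sum_range_succ]
  ring

lemma exp_sub_sum_range_isBigO {α : Type*} {l : Filter α} {f E g : α → ℝ} {N : ℕ}
    (hN : N ≠ 0) (hg : Tendsto g l (𝓝 0)) (hE : E =O[l] g)
    (hfE : (fun x => f x - E x) =O[l] fun x => g x ^ N) :
    (fun x => Real.exp (f x) - ∑ i ∈ Finset.range N, E x ^ i / i !) =O[l] fun x => g x ^ N := by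
  have hE0 : Tendsto E l (𝓝 0) := hE.trans_tendsto hg
  have hfE0 : Tendsto (fun x => f x - E x) l (𝓝 0) :=
    hfE.trans_tendsto (by simpa [hN] using hg.pow N)
  have hexpE : (fun x => Real.exp (E x)) =O[l] fun _ => (1 : ℝ) :=
    ((Real.continuous_exp.tendsto 0).comp hE0).isBigO_one ℝ
  have hdiff : (fun x => Real.exp (f x - E x) - 1) =O[l] fun x => g x ^ N := by
    simpa [Function.comp_def] using
      ((Real.exp_sub_sum_range_isBigO_pow 1).comp_tendsto hfE0).trans
        (by simpa [Function.comp_def] using hfE)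
  have htaylor : (fun x => Real.exp (E x) - ∑ i ∈ Finset.range N, E x ^ i / i !) =O[l]
      fun x => g x ^ N :=
    ((Real.exp_sub_sum_range_isBigO_pow N).comp_tendsto hE0).trans (hE.pow N)
  refine ((hexpE.mul hdiff).congr_right fun _ => one_mul _).add htaylor |>.congr_left fun x => ?_
  rw [mul_sub, ← Real.exp_add]
  ring_nf

lemma exp_logZetaProd_isBigO :
    (fun x => Real.exp (logZetaProd 2 x - logZetaProd 3 x) -
      (1 - zetaSum 2 * x ^ 2 + zetaSum 3 * x ^ 3 + (zetaSum 2 ^ 2 - zetaSum 4) / 2 * x ^ 4 -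
        zetaSum 2 * zetaSum 3 * x ^ 5)) =O[𝓝 0] fun x => x ^ 6 := by
  have hbdd : ∀ {p : ℝ → ℝ}, Continuous p → p =O[𝓝 0] fun _ => (1 : ℝ) := fun hp =>
    hp.continuousAt.isBigO_one ℝ
  have hE : (fun x => -zetaSum 2 * x ^ 2 + zetaSum 3 * x ^ 3 - zetaSum 4 / 2 * x ^ 4)
      =O[𝓝 0] fun x => x ^ 2 := by
    refine ((isBigO_refl (fun x : ℝ => x ^ 2) (𝓝 0)).mul (hbdd (p := fun x =>
      -zetaSum 2 + zetaSum 3 * x - zetaSum 4 / 2 * x ^ 2) (by fun_prop))).congr ?_ ?_ <;>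
    intro x <;> ring
  have hexp := exp_sub_sum_range_isBigO (N := 3) (by norm_num)
    ((continuous_pow 2).tendsto' 0 0 (by norm_num)) hE
    (logZetaProd_two_sub_three_isBigO.congr_right fun x => by ring)
  have htail := (isBigO_refl (fun x : ℝ => x ^ 6) (𝓝 0)).mul (hbdd (p := fun x =>
    (zetaSum 3 ^ 2 + zetaSum 2 * zetaSum 4) / 2 - zetaSum 3 * zetaSum 4 / 2 * x +
      zetaSum 4 ^ 2 / 8 * x ^ 2) (by fun_prop))
  refine ((hexp.congr_right fun x => ?_).add (htail.congr_right fun x => mul_one _)).congr_left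
    fun x => ?_
  · ring
  · simp only [Finset.sum_range_succ, Finset.sum_range_zero, Nat.factorial]
    push_cast
    ring

/-! ### Comparison of coefficients -/

lemma eq_zero_of_sum_mul_pow_isBigO {𝕜 : Type*} [NormedField 𝕜] {l : Filter 𝕜} [l.NeBot]
    (hl : l ≤ 𝓝[≠] 0) {N : ℕ} {c : Fin N → 𝕜}
    (h : (fun x => ∑ m, c m * x ^ (m : ℕ)) =O[l] fun x => x ^ N) : c = 0 := by
  classical
  have hdvd : X ^ N ∣ ofFn N c :=
    X_pow_dvd_of_eval_isBigO hl <| by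
      simpa [ofFn_eq_sum_monomial, eval_finsetSum] using h
  ext m
  rw [← ofFn_coeff_eq_val_of_lt c m.2, X_pow_dvd_iff.1 hdvd m m.2, Pi.zero_apply]

lemma softplusCoeff_cubeRootKernel (m : Fin 5) :
    softplusCoeff (-1) (taylorCoeff cubeRootKernel) m =
      ![0, -zetaSum 2 / 2, zetaSum 3 / 2, (zetaSum 2 ^ 2 - zetaSum 4) / 4,
        -(zetaSum 2 * zetaSum 3) / 2] m := by
  set I := softplusCoeff (-1) (taylorCoeff cubeRootKernel)
  set t : Fin 5 → ℝ := ![0, -zetaSum 2 / 2, zetaSum 3 / 2, (zetaSum 2 ^ 2 - zetaSum 4) / 4,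
    -(zetaSum 2 * zetaSum 3) / 2]
  obtain ⟨D, hD⟩ := exists_hasExpansionOn_softplusTransform (σ := -1) (by simp)
    continuous_cubeRootKernel hasExpansionOn_cubeRootKernel
  have htransform : (fun x => 2 * x * (softplusTransform (-1) cubeRootKernel x -
      ∑ k ∈ Finset.range 5, I k * x ^ k)) =O[𝓝[>] 0] fun x => x ^ 6 :=
    (((isBigO_refl (fun x : ℝ => x) _).const_mul_left 2).mul (hD.isBigO 5)).congr_right
      fun x => (pow_succ' x 5).symm
  have hzeta := exp_logZetaProd_isBigO.mono (nhdsWithin_le_nhds (s := Ioi 0))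
  have hsum : (fun x => ∑ m, (Fin.cons 0 fun m => 2 * (I m - t m) : Fin 6 → ℝ) m * x ^ (m : ℕ))
      =O[𝓝[>] 0] fun x => x ^ 6 := by
    refine (hzeta.sub htransform).congr' ?_ .rfl
    filter_upwards [Ioo_mem_nhdsGT one_pos] with x hx
    rw [← one_add_two_mul_softplusTransform_cubeRootKernel hx.1 hx.2, Fin.sum_univ_succ]
    simp only [Finset.sum_range_succ, Finset.sum_range_zero, Fin.cons_zero, Fin.cons_succ,
      Fin.sum_univ_five, t]
    simp
    ring
  have hcoeff := congr_fun (eq_zero_of_sum_mul_pow_isBigO (nhdsGT_le_nhdsNE 0) hsum) m.succ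
  simpa [sub_eq_zero] using hcoeff

/-- The coefficients of the asymptotic expansion of `powerMeanIntegral`. -/
noncomputable def powerMeanCoeff : ℕ → ℝ
  | 0 => 3 / 4
  | m + 1 => 2 * softplusCoeff 1 (taylorCoeff sigmoidKernel) m

lemma hasAsymptoticExpansion_powerMeanIntegral :
    HasAsymptoticExpansion powerMeanIntegral powerMeanCoeff := by
  obtain ⟨C, hC⟩ := exists_hasExpansionOn_sigmoidKernel
  obtain ⟨D, hD⟩ := exists_hasExpansionOn_softplusTransform (σ := 1) (by simp)
    continuous_sigmoidKernel hC
  exact hD.hasAsymptoticExpansion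
    ((eventually_gt_atTop 0).mono fun n hn => powerMeanIntegral_eq hn) fun m => rfl

lemma powerMeanCoeff_succ (m : Fin 5) :
    powerMeanCoeff (m + 1) =
      ![0, zetaSum 2 / 8, zetaSum 3 / 8, (zetaSum 4 - zetaSum 2 ^ 2) / 16,
        -(zetaSum 2 * zetaSum 3) / 8] m := by
  have h := softplusCoeff_neg (σ := -1) (m := m) fun k hk =>
    taylorCoeff_sigmoidKernel (show k < 4 by lia)
  rw [neg_neg, softplusCoeff_cubeRootKernel] at h
  rw [powerMeanCoeff, h]
  fin_cases m <;> simp <;> ring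

theorem theorem1 :
    ∃ c : ℕ → ℝ, HasAsymptoticExpansion powerMeanIntegral c ∧
      c 0 = 3 / 4 ∧
      c 1 = 0 ∧
      c 2 = Real.pi ^ 2 / 48 ∧
      (c 3 : ℂ) = riemannZeta 3 / 8 ∧
      c 4 = -(Real.pi ^ 4 / 960) ∧
      (c 5 : ℂ) = -(riemannZeta 3 * (Real.pi : ℂ) ^ 2 / 48) := by
  have hζ₃ : riemannZeta 3 = zetaSum 3 := mod_cast (ofReal_zetaSum (k := 3) (by norm_num)).symm
  have h₂ : powerMeanCoeff 2 = zetaSum 2 / 8 := powerMeanCoeff_succ 1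
  have h₃ : powerMeanCoeff 3 = zetaSum 3 / 8 := powerMeanCoeff_succ 2
  have h₄ : powerMeanCoeff 4 = (zetaSum 4 - zetaSum 2 ^ 2) / 16 := powerMeanCoeff_succ 3
  have h₅ : powerMeanCoeff 5 = -(zetaSum 2 * zetaSum 3) / 8 := powerMeanCoeff_succ 4
  refine ⟨powerMeanCoeff, hasAsymptoticExpansion_powerMeanIntegral, rfl, powerMeanCoeff_succ 0,
    ?_, ?_, ?_, ?_⟩
  · rw [h₂, zetaSum_two]
    ring
  · rw [h₃, hζ₃, Complex.ofReal_div, Complex.ofReal_ofNat]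
  · rw [h₄, zetaSum_two, zetaSum_four]
    ring
  · rw [h₅, hζ₃, zetaSum_two]
    push_cast
    ring
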